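/- \textbf{Model.} Let $\lambda:[0,\infty)\to[0,\infty)$ be measurable with $\Lambda(t)=\int_0^t\lambda(s)\,ds<\infty$ for all $t$, let $h:[0,\infty)\to[0,\infty)$ and $p:[0,\infty)\to[0,1]$ be measurable, put $q=1-p$, let $\mu$ be a probability measure on $\mathbb{R}^2$ carried by $[0,\infty)^2$, and let $L\in\mathbb{R}$. Shocks occur at the points $0<T_1<T_2<\dots$ of a non-homogeneous Poisson process $(N_t)_{t\ge 0}$ with intensity $\lambda(t)\,dt$ (with $T_n=\infty$ if there are fewer than $n$ points). The random vectors $V_n=(V_n^{(1)},V_n^{(2)})$, $n\ge1$, are i.i.d. with law $\mu$ and independent of $(T_n)_{n\ge1}$. Put $A_t=(A_t^{(1)},A_t^{(2)})=\sum_{k=1}^{N_t}V_k$ and $\mathcal{F}_t=\sigma\big((N_s,A_s):s\le t\big)$. Let $(G_t)_{t\ge0}$ be a real-valued process with nondecreasing paths, independent of the process $(N_t,A_t)_{t\ge0}$. The system has three failure modes, with the following $[0,\infty]$-valued failure times: \begin{itemize} \item $\tau_1$ has conditional hazard rate $h(t)+A_t^{(1)}$, that is, $\mathbb{P}(\tau_1>t\mid\mathcal{F}_t)=\exp\big(-\int_0^t(h(s)+A_s^{(1)})\,ds\big)$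 a.s. for all $t\ge0$; \item $\tau_2=\inf\{t\ge0: G_t+A_t^{(2)}>L\}$; \item $\tau_3=\inf\{T_n: n\ge1,\ \text{the } n\text{-th shock is fatal}\}$, where $\mathbb{P}(\tau_3>t\mid\mathcal{F}_t)=\prod_{i=1}^{N_t}q(T_i)$ a.s. for all $t\ge0$. \end{itemize} For all $t\ge0$ the events $\{\tau_i>t\}$ satisfy $\mathbb{P}(\tau_1>t,\tau_2>t,\tau_3>t\mid\mathcal{F}_t)=\prod_{i=1}^3\mathbb{P}(\tau_i>t\mid\mathcal{F}_t)$ a.s. The lifetime of the system is $\tau=\min(\tau_1,\tau_2,\tau_3)$. \textbf{Proposition.} Consider two such systems, possibly on different probability spaces, with the same $h$, $q$, $\mu$, $L$ and the same law of the process $(G_t)_{t\ge0}$, and with cumulated shock intensities $\Lambda$ and $\tilde\Lambda$ respectively; let $\tau$ and $\tilde\tau$ be their lifetimes. Assume that $\Lambda(t)\ge\tilde\Lambda(t)$ for all $t\ge0$ and that $q$ is nondecreasing. Then $\tau\le_{st}\tilde\tau$, that is, $\mathbb{P}(\tau>t)\le\mathbb{P}(\tilde\tau>t)$ for all $t\ge0$.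 -/

import Mathlib

open MeasureTheory ProbabilityTheory
open scoped NNReal ENNReal

namespace ShockModel

noncomputable section

/-- The parameters of the system other than the shock intensity. -/
structure SystemParams where
  /-- intrinsic hazard rate of the first component -/
  h : ℝ≥0 → ℝ≥0
  measurable_h : Measurable h
  /-- probability for a shock at time `t` to be fatal -/
  p : ℝ≥0 → ℝ
  measurable_p : Measurable p
  p_mem : ∀ t, p t ∈ Set.Icc (0 : ℝ) 1
  /-- common law of the increments (hazard rate of component 1, deterioration of component 2) -/
  μ : Measure (ℝ × ℝ)
  prob_μ : IsProbabilityMeasure μ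
  nonneg_μ : ∀ᵐ v ∂μ, 0 ≤ v.1 ∧ 0 ≤ v.2
  /-- law of the intrinsic deterioration process of the second component -/
  lawG : Measure (ℝ≥0 → ℝ)
  /-- failure threshold for the deterioration of the second component -/
  L : ℝ

/-- The probability for a shock at time `t` to be non fatal. -/
def SystemParams.q (θ : SystemParams) (t : ℝ≥0) : ℝ := 1 - θ.p t

/-- A locally integrable intensity function of a non-homogeneous Poisson process. -/
structure ShockIntensity where
  rate : ℝ≥0 → ℝ≥0
  measurable_rate : Measurable rate
  finite : ∀ t : ℝ≥0, ∫⁻ s in Set.Icc (0 : ℝ) t, (rate s.toNNReal : ℝ≥0∞) ≠ ∞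

/-- The cumulated intensity `Λ(t) = ∫₀ᵗ λ(s) ds`. -/
def ShockIntensity.cumul (lam : ShockIntensity) (t : ℝ≥0) : ℝ≥0 :=
  (∫⁻ s in Set.Icc (0 : ℝ) t, (lam.rate s.toNNReal : ℝ≥0∞)).toNNReal

/-- Number of points of the sequence `T` in `[0, t]`. -/
def count {Ω : Type*} (T : ℕ → Ω → ℝ≥0∞) (t : ℝ≥0) (ω : Ω) : ℕ :=
  {n : ℕ | T n ω ≤ (t : ℝ≥0∞)}.ncard

/-- `T 0 < T 1 < ...` are the points of a non-homogeneous Poisson process with intensity `lam`.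
The value `∞` is used for the missing points when there are only finitely many of them. -/
structure IsPoissonArrivals {Ω : Type*} [MeasurableSpace Ω] (P : Measure Ω)
    (lam : ShockIntensity) (T : ℕ → Ω → ℝ≥0∞) : Prop where
  measurable : ∀ n, Measurable (T n)
  pos : ∀ᵐ ω ∂P, 0 < T 0 ω
  ordered : ∀ᵐ ω ∂P, ∀ n, T n ω < T (n + 1) ω ∨ (T n ω = ∞ ∧ T (n + 1) ω = ∞)
  locallyFinite : ∀ᵐ ω ∂P, ∀ t : ℝ≥0, {n : ℕ | T n ω ≤ (t : ℝ≥0∞)}.Finite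
  indepIncrements : HasIndepIncrements (count T) P
  law : ∀ s t : ℝ≥0, s ≤ t →
    HasLaw (fun ω => count T t ω - count T s ω) (poissonMeasure (lam.cumul t - lam.cumul s)) P

/-- The random ingredients of a system. The shocks are numbered from `0`. -/
structure System (Ω : Type*) where
  /-- arrival times of the shocks -/
  T : ℕ → Ω → ℝ≥0∞
  /-- increments (hazard rate of component 1, deterioration of component 2) at the shocks -/
  V : ℕ → Ω → ℝ × ℝ
  /-- intrinsic deterioration of the second component -/
  G : ℝ≥0 → Ω → ℝ
  /-- `fatal n` is the event that the `n`-th shock is fatal -/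
  fatal : ℕ → Set Ω
  /-- lifetime of the first component, fatal shocks being ignored -/
  τ₁ : Ω → ℝ≥0∞

namespace System

variable {Ω : Type*} (S : System Ω)

/-- The shock counting process. -/
def N (t : ℝ≥0) (ω : Ω) : ℕ := count S.T t ω

/-- The bivariate compound Poisson process. -/
def A (t : ℝ≥0) (ω : Ω) : ℝ × ℝ := ∑ k ∈ Finset.range (S.N t ω), S.V k ω

/-- The σ-field generated by the shocks (arrivals and cumulated increments) up to time `t`. -/
@[reducible]
def history (t : ℝ≥0) : MeasurableSpace Ω :=
  ⨆ s : Set.Iic t, MeasurableSpace.comap (fun ω => (S.N s ω, S.A s ω)) inferInstance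

/-- The cumulated hazard `∫₀ᵗ (h(s) + A_s⁽¹⁾) ds` of the first component, possibly infinite. -/
def cumulHazard (θ : SystemParams) (t : ℝ≥0) (ω : Ω) : ℝ≥0∞ :=
  ∫⁻ s in Set.Icc (0 : ℝ) t,
    ((θ.h s.toNNReal : ℝ≥0∞) + ENNReal.ofReal (S.A s.toNNReal ω).1)

/-- The deterioration of the second component in the stressing environment. -/
def deterioration (t : ℝ≥0) (ω : Ω) : ℝ := S.G t ω + (S.A t ω).2

/-- Lifetime of the second component, fatal shocks being ignored:
the first time at which its deterioration exceeds the threshold. -/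
def τ₂ (θ : SystemParams) (ω : Ω) : ℝ≥0∞ :=
  ⨅ (t : ℝ≥0) (_ : θ.L < S.deterioration t ω), (t : ℝ≥0∞)

/-- Time of the first fatal shock. -/
def τ₃ (ω : Ω) : ℝ≥0∞ := ⨅ (n : ℕ) (_ : ω ∈ S.fatal n), S.T n ω

/-- Lifetime of the system. -/
def lifetime (θ : SystemParams) (ω : Ω) : ℝ≥0∞ := min (S.τ₁ ω) (min (S.τ₂ θ ω) (S.τ₃ ω))

/-- `S` is a system with parameters `θ` whose shocks arrive with intensity `lam`. -/
structure IsModel [MeasurableSpace Ω] (P : Measure Ω) (θ : SystemParams)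
    (lam : ShockIntensity) : Prop where
  arrivals : IsPoissonArrivals P lam S.T
  measurable_V : ∀ n, Measurable (S.V n)
  law_V : ∀ n, HasLaw (S.V n) θ.μ P
  iIndep_V : iIndepFun S.V P
  indep_V_T : IndepFun (fun ω n => S.V n ω) (fun ω n => S.T n ω) P
  measurable_G : ∀ t, Measurable (S.G t)
  monotone_G : ∀ᵐ ω ∂P, Monotone (fun t => S.G t ω)
  law_G : HasLaw (fun ω t => S.G t ω) θ.lawG P
  indep_G : IndepFun (fun ω t => S.G t ω) (fun ω t => (S.N t ω, S.A t ω)) P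
  measurable_τ₁ : Measurable S.τ₁
  measurable_fatal : ∀ n, MeasurableSet (S.fatal n)
  /-- the first component has conditional hazard rate `h(t) + A_t⁽¹⁾` given the shocks -/
  hazard : ∀ t : ℝ≥0, P⟦{ω | (t : ℝ≥0∞) < S.τ₁ ω}|S.history t⟧ =ᵐ[P]
    fun ω => (EReal.exp (-(S.cumulHazard θ t ω : EReal))).toReal
  /-- given the shocks, the Bernoulli trials are independent, with probability `q(T_n)` for
  the `n`-th shock to be non fatal, in the sense that the probability of no fatal shock up to
  time `t` is the product of the `q(T_i)` over the shocks up to time `t` -/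
  bernoulli : ∀ t : ℝ≥0, P⟦{ω | (t : ℝ≥0∞) < S.τ₃ ω}|S.history t⟧ =ᵐ[P]
    fun ω => ∏ i ∈ Finset.range (S.N t ω), θ.q (S.T i ω).toNNReal
  /-- conditional independence of the three failure modes given the shocks -/
  condIndep : ∀ t : ℝ≥0,
    P⟦{ω | (t : ℝ≥0∞) < S.τ₁ ω ∧ (t : ℝ≥0∞) < S.τ₂ θ ω ∧ (t : ℝ≥0∞) < S.τ₃ ω}|S.history t⟧
      =ᵐ[P] fun ω =>
        (P⟦{ω | (t : ℝ≥0∞) < S.τ₁ ω}|S.history t⟧) ω *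
        (P⟦{ω | (t : ℝ≥0∞) < S.τ₂ θ ω}|S.history t⟧) ω *
        (P⟦{ω | (t : ℝ≥0∞) < S.τ₃ ω}|S.history t⟧) ω

end System

/-- The standard stochastic order between two lifetimes, possibly defined on different
probability spaces. -/
def StochLE {Ω Ω' : Type*} [MeasurableSpace Ω] [MeasurableSpace Ω'] (P : Measure Ω)
    (X : Ω → ℝ≥0∞) (P' : Measure Ω') (Y : Ω' → ℝ≥0∞) : Prop :=
  ∀ t : ℝ≥0, P {ω | (t : ℝ≥0∞) < X ω} ≤ P' {ω | (t : ℝ≥0∞) < Y ω}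

end

end ShockModel

/-! Given the shocks up to `t`, the system survives with probability `survival`: the product of the
exponential of minus the cumulated hazard, a nonincreasing function of `A_t⁽²⁾`, and the product of
the `q(T_i)` over the shocks before `t` (`IsModel.measure_lt_lifetime`). This is a pathwise
functional of the arrivals and increments alone. As the increments are nonnegative and `q` is
nondecreasing, delaying every shock while keeping the increments raises each factor: less damage is
accumulated by any time, fewer factors `q ≤ 1` remain, and the remaining ones are evaluated later
(`survival_le`).

It remains to couple the two sets of arrivals. With `σ(s)` the first time at which `Λ` reaches
`Λ'(s)`, continuity gives `Λ(σ(s)) = Λ'(s)`, and `Λ' ≤ Λ` gives `σ(s) ≤ s`. The slowed process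
`N_{σ(s)}` therefore lies below `N_s` and has the law of the other counting process
(`map_count_timeChange`). Its points are later than the `T_n`, have the law of the other arrivals,
and are a function of `T`, hence independent of the increments. The slowed system thus bounds the
first mean survival probability from above and attains the second (`IsModel.integral_survival_le`).
-/

namespace ShockModel

/-! ### The cumulated intensity and the time change between two intensities -/

namespace ShockIntensity

variable (lam lam' : ShockIntensity)

lemma coe_cumul (t : ℝ≥0) :
    (lam.cumul t : ℝ≥0∞) = ∫⁻ s in Set.Icc (0 : ℝ) t, (lam.rate s.toNNReal : ℝ≥0∞) :=
  ENNReal.coe_toNNReal (lam.finite t)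

lemma measurable_rate_toNNReal : Measurable fun s : ℝ => lam.rate s.toNNReal :=
  lam.measurable_rate.comp measurable_real_toNNReal

lemma integrableOn_rate (t : ℝ≥0) :
    IntegrableOn (fun s : ℝ => (lam.rate s.toNNReal : ℝ)) (Set.Icc 0 t) := by
  refine ⟨lam.measurable_rate_toNNReal.coe_nnreal_real.aestronglyMeasurable, ?_⟩
  rw [hasFiniteIntegral_iff_ofReal (Filter.Eventually.of_forall fun _ => NNReal.coe_nonneg _)]
  simpa using (lam.finite t).lt_top

lemma coe_cumul_eq_integral (t : ℝ≥0) :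
    (lam.cumul t : ℝ) = ∫ s in Set.Icc (0 : ℝ) t, (lam.rate s.toNNReal : ℝ) := by
  rw [integral_eq_lintegral_of_nonneg_ae
    (Filter.Eventually.of_forall fun _ => NNReal.coe_nonneg _)
    lam.measurable_rate_toNNReal.coe_nnreal_real.aestronglyMeasurable]
  simp [cumul, ENNReal.toReal]

lemma cumul_zero : lam.cumul 0 = 0 := by simp [cumul]

lemma monotone_cumul : Monotone lam.cumul := by
  intro s t hst
  rw [← ENNReal.coe_le_coe, coe_cumul, coe_cumul]
  exact lintegral_mono_set (Set.Icc_subset_Icc_right (by exact_mod_cast hst))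

lemma continuousOn_cumul (t : ℝ≥0) : ContinuousOn lam.cumul (Set.Icc 0 t) := by
  have h := intervalIntegral.continuousOn_primitive_Icc (lam.integrableOn_rate t)
  rw [NNReal.isEmbedding_coe.continuousOn_iff]
  refine (h.comp NNReal.continuous_coe.continuousOn (fun s hs => ?_)).congr
    fun s _ => lam.coe_cumul_eq_integral s
  exact ⟨NNReal.coe_nonneg _, by exact_mod_cast hs.2⟩

lemma continuous_cumul : Continuous lam.cumul := by
  rw [continuous_iff_continuousAt]
  intro s
  refine (lam.continuousOn_cumul (s + 1)).continuousAt ?_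
  rw [← bot_eq_zero, Set.Icc_bot]
  exact Iic_mem_nhds (lt_add_one s)

/-- The first time at which the cumulated intensity of `lam` reaches that of `lam'` at `s`. -/
noncomputable def timeChange (s : ℝ≥0) : ℝ≥0 := sInf {r | lam'.cumul s ≤ lam.cumul r}

variable {lam lam'}

lemma timeChange_le (hΛ : ∀ t, lam'.cumul t ≤ lam.cumul t) (s : ℝ≥0) :
    lam.timeChange lam' s ≤ s :=
  csInf_le (OrderBot.bddBelow _) (hΛ s)

lemma cumul_timeChange (hΛ : ∀ t, lam'.cumul t ≤ lam.cumul t) (s : ℝ≥0) :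
    lam.cumul (lam.timeChange lam' s) = lam'.cumul s := by
  refine le_antisymm ?_ ?_
  -- Some `r ≤ s` attains the level exactly, and the infimum lies below it; conversely the infimum
  -- belongs to the closed set that defines it.
  · obtain ⟨r, -, hr⟩ := intermediate_value_Icc (zero_le (a := s)) (lam.continuousOn_cumul s)
      ⟨by simp [cumul_zero], hΛ s⟩
    exact (lam.monotone_cumul (csInf_le (OrderBot.bddBelow _) hr.ge)).trans hr.le
  · exact (isClosed_le continuous_const lam.continuous_cumul).csInf_mem ⟨s, hΛ s⟩
      (OrderBot.bddBelow _)

lemma monotone_timeChange (hΛ : ∀ t, lam'.cumul t ≤ lam.cumul t) :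
    Monotone (lam.timeChange lam') := fun _ t hst =>
  csInf_le_csInf (OrderBot.bddBelow _) ⟨t, hΛ t⟩
    fun _ hr => (lam'.monotone_cumul hst).trans hr

end ShockIntensity

/-! ### Counting processes with independent increments -/

/-- A finite set of times is contained in the range of a monotone sequence starting at zero. -/
lemma exists_monotone_seq (I : Finset ℝ≥0) :
    ∃ t : ℕ → ℝ≥0, Monotone t ∧ t 0 = 0 ∧ ∀ s ∈ I, ∃ k, t k = s := by
  -- The extra bound keeps the sequence below the next, larger time, so that this time can be
  -- appended after the last useful index.
  suffices h : ∃ t : ℕ → ℝ≥0, Monotone t ∧ t 0 = 0 ∧ (∀ s ∈ I, ∃ k, t k = s) ∧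
      ∀ a, (∀ s ∈ I, s < a) → ∀ k, t k ≤ a by
    obtain ⟨t, h1, h2, h3, -⟩ := h
    exact ⟨t, h1, h2, h3⟩
  induction I using Finset.induction_on_max with
  | empty => exact ⟨fun _ => 0, monotone_const, rfl, by simp, by simp⟩
  | insert a I ha ih =>
    obtain ⟨t, h1, h2, h3, h4⟩ := ih
    choose! k hk using h3
    refine ⟨fun i => if i ≤ I.sup k then t i else a, ?_, by simp [h2], ?_, ?_⟩
    · intro i j hij
      dsimp only
      split_ifs with hi hj
      · exact h1 hij
      · exact h4 a ha i
      · omega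
      · exact le_rfl
    · intro s hs
      rcases Finset.mem_insert.1 hs with rfl | hs
      · exact ⟨I.sup k + 1, if_neg (by omega)⟩
      · exact ⟨k s, (if_pos (Finset.le_sup hs)).trans (hk s hs)⟩
    · intro b hb i
      dsimp only
      split_ifs
      · exact h4 b (fun s hs => hb s (Finset.mem_insert_of_mem hs)) i
      · exact (hb a (Finset.mem_insert_self _ _)).le

/-- The finite dimensional distributions of a counting process with independent increments are
images of the joint law of its increments. -/
lemma map_restrict_of_hasIndepIncrements {Ω : Type*} [MeasurableSpace Ω] {P : Measure Ω}
    {X : ℝ≥0 → Ω → ℕ} {ν : ℝ≥0 → ℝ≥0 → Measure ℕ}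
    (hX : ∀ t, Measurable (X t)) (hX0 : ∀ᵐ ω ∂P, X 0 ω = 0)
    (hXm : ∀ᵐ ω ∂P, Monotone fun t => X t ω) (hXi : HasIndepIncrements X P)
    (hXl : ∀ s t, s ≤ t → HasLaw (fun ω => X t ω - X s ω) (ν s t) P)
    {I : Finset ℝ≥0} {t : ℕ → ℝ≥0} (ht : Monotone t) (ht0 : t 0 = 0)
    {k : ℝ≥0 → ℕ} (hk : ∀ s ∈ I, t (k s) = s) :
    P.map (fun ω => I.restrict fun t => X t ω) =
      (Measure.infinitePi fun i => ν (t i) (t (i + 1))).map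
        (fun (x : ℕ → ℕ) (s : I) => ∑ i ∈ Finset.range (k s), x i) := by
  have hm : Measurable fun ω i => X (t (i + 1)) ω - X (t i) ω :=
    measurable_pi_lambda _ fun i => (hX _).sub (hX _)
  have hφ : Measurable fun (x : ℕ → ℕ) (s : I) => ∑ i ∈ Finset.range (k s), x i :=
    measurable_pi_lambda _ fun s => Finset.measurable_sum _ fun i _ => measurable_pi_apply i
  rw [← (iIndepFun.hasLaw_infinitePi (fun i => hXl _ _ (ht i.le_succ)) (hXi.nat ht)
    hm.aemeasurable).map_eq, Measure.map_map hφ hm]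
  refine Measure.map_congr ?_
  -- Increments are truncated differences in `ℕ`, so they telescope only along monotone paths.
  filter_upwards [hX0, hXm] with ω h0 hω
  funext s
  simp only [Finset.restrict, Function.comp_apply]
  rw [Finset.sum_range_tsub (f := fun i => X (t i) ω) (hω.comp ht), hk s s.2, ht0, h0,
    Nat.sub_zero]

/-- The law of a counting process with independent increments is determined by the laws of its
increments. -/
lemma map_eq_of_hasIndepIncrements {Ω Ω' : Type*} [MeasurableSpace Ω] [MeasurableSpace Ω']
    {P : Measure Ω} [IsFiniteMeasure P] {P' : Measure Ω'} [IsFiniteMeasure P']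
    {X : ℝ≥0 → Ω → ℕ} {Y : ℝ≥0 → Ω' → ℕ} (ν : ℝ≥0 → ℝ≥0 → Measure ℕ)
    (hX : ∀ t, Measurable (X t)) (hY : ∀ t, Measurable (Y t))
    (hX0 : ∀ᵐ ω ∂P, X 0 ω = 0) (hY0 : ∀ᵐ ω ∂P', Y 0 ω = 0)
    (hXm : ∀ᵐ ω ∂P, Monotone fun t => X t ω) (hYm : ∀ᵐ ω ∂P', Monotone fun t => Y t ω)
    (hXi : HasIndepIncrements X P) (hYi : HasIndepIncrements Y P')
    (hXl : ∀ s t, s ≤ t → HasLaw (fun ω => X t ω - X s ω) (ν s t) P)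
    (hYl : ∀ s t, s ≤ t → HasLaw (fun ω => Y t ω - Y s ω) (ν s t) P') :
    P.map (fun ω t => X t ω) = P'.map (fun ω t => Y t ω) := by
  have hmX : Measurable fun ω t => X t ω := measurable_pi_lambda _ hX
  have hmY : Measurable fun ω t => Y t ω := measurable_pi_lambda _ hY
  refine (isProjectiveLimit_map hmX.aemeasurable).unique fun I => ?_
  obtain ⟨t, ht, ht0, hI⟩ := exists_monotone_seq I
  choose! k hk using hI
  beta_reduce
  rw [map_restrict_of_hasIndepIncrements hX hX0 hXm hXi hXl ht ht0 hk,
    ← map_restrict_of_hasIndepIncrements hY hY0 hYm hYi hYl ht ht0 hk,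
    Measure.map_map (Finset.measurable_restrict _) hmY]
  rfl

end ShockModel
namespace ShockModel

/-! ### Counting the points of a sequence -/

section Count

variable {Ω : Type*} {T : ℕ → Ω → ℝ≥0∞} {ω : Ω}

/-- The indices of points in `[0, t]` form an initial segment of `ℕ`. Finiteness matters because
`ncard` is `0` on infinite sets. -/
lemma lt_count_iff (hT : Monotone fun n => T n ω) {t : ℝ≥0}
    (hfin : {n | T n ω ≤ (t : ℝ≥0∞)}.Finite) {n : ℕ} : n < count T t ω ↔ T n ω ≤ t := by
  constructor
  · intro hn
    by_contra! h
    have hsub : {n | T n ω ≤ (t : ℝ≥0∞)} ⊆ (Finset.range n : Set ℕ) := by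
      intro m hm
      by_contra hmn
      exact absurd ((hT (by simpa using hmn)).trans hm) h.not_ge
    have := Set.ncard_le_ncard hsub (Finset.finite_toSet _)
    rw [Set.ncard_coe_finset, Finset.card_range] at this
    exact absurd hn (not_lt.2 this)
  · intro hn
    have hsub : (Finset.range (n + 1) : Set ℕ) ⊆ {n | T n ω ≤ (t : ℝ≥0∞)} := by
      intro m hm
      exact (hT (Nat.lt_succ_iff.1 (by simpa using hm))).trans hn
    have := Set.ncard_le_ncard hsub hfin
    rwa [Set.ncard_coe_finset, Finset.card_range] at this

lemma monotone_count (hfin : ∀ t : ℝ≥0, {n | T n ω ≤ (t : ℝ≥0∞)}.Finite) :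
    Monotone fun t => count T t ω := fun _ t hst =>
  Set.ncard_le_ncard (fun _ hn => le_trans hn (ENNReal.coe_le_coe.2 hst)) (hfin t)

lemma count_anti {T' : ℕ → Ω → ℝ≥0∞} (h : ∀ n, T n ω ≤ T' n ω) {t : ℝ≥0}
    (hfin : {n | T n ω ≤ (t : ℝ≥0∞)}.Finite) : count T' t ω ≤ count T t ω :=
  Set.ncard_le_ncard (fun n hn => (h n).trans hn) hfin

lemma count_zero (hpos : 0 < T 0 ω) (hT : Monotone fun n => T n ω) : count T 0 ω = 0 := by
  have : {n | T n ω ≤ ((0 : ℝ≥0) : ℝ≥0∞)} = ∅ := by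
    ext n
    simpa using (hpos.trans_le (hT n.zero_le)).ne'
  rw [count, this, Set.ncard_empty]

/-- Right-continuity of the count: only finitely many points fall in `(t, b]`, so `u` can be taken
before the first of them. -/
lemma exists_count_eq_right (hfin : ∀ t : ℝ≥0, {n | T n ω ≤ (t : ℝ≥0∞)}.Finite)
    {t b : ℝ≥0} (htb : t < b) : ∃ u, t < u ∧ u ≤ b ∧ count T u ω = count T t ω := by
  have hF : {n | (t : ℝ≥0∞) < T n ω ∧ T n ω ≤ b}.Finite := (hfin b).subset fun n hn => hn.2
  obtain ⟨c, htc, hc⟩ : ∃ c : ℝ≥0∞, (t : ℝ≥0∞) < c ∧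
      ∀ n, (t : ℝ≥0∞) < T n ω → T n ω ≤ b → c ≤ T n ω := by
    rcases hF.toFinset.eq_empty_or_nonempty with h | h
    · refine ⟨∞, ENNReal.coe_lt_top, fun n h1 h2 => ?_⟩
      have : n ∈ hF.toFinset := by simp [h1, h2]
      simp [h] at this
    · obtain ⟨m, hm, hmin⟩ := hF.toFinset.exists_min_image (fun n => T n ω) h
      refine ⟨T m ω, ?_, fun n h1 h2 => hmin n (by simp [h1, h2])⟩
      exact ((Set.Finite.mem_toFinset _).1 hm).1
  obtain ⟨u, htu, hu⟩ := ENNReal.lt_iff_exists_nnreal_btwn.1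
    (lt_min htc (ENNReal.coe_lt_coe.2 htb))
  rw [lt_min_iff, ENNReal.coe_lt_coe] at hu
  rw [ENNReal.coe_lt_coe] at htu
  refine ⟨u, htu, hu.2.le, congrArg Set.ncard (Set.ext fun n => ⟨fun hn => ?_, fun hn =>
    le_trans hn (ENNReal.coe_le_coe.2 htu.le)⟩)⟩
  by_contra hnt
  have := hc n (not_le.1 hnt) (le_trans hn (ENNReal.coe_le_coe.2 hu.2.le))
  exact absurd (hu.1.trans_le this) (not_lt.2 hn)

lemma measurable_count [MeasurableSpace Ω] (hT : ∀ n, Measurable (T n)) :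
    Measurable fun x : ℝ≥0 × Ω => count T x.1 x.2 := by
  -- A series of indicators is jointly measurable. When infinitely many points are counted, `toReal`
  -- sends the sum `∞` to `0`, which agrees with `ncard`.
  have heq : (fun x : ℝ≥0 × Ω => count T x.1 x.2) = fun x => ⌊(∑' n,
      {x : ℝ≥0 × Ω | T n x.2 ≤ (x.1 : ℝ≥0∞)}.indicator (fun _ => (1 : ℝ≥0∞)) x).toReal⌋₊ := by
    funext x
    have h1 : (∑' n, {x : ℝ≥0 × Ω | T n x.2 ≤ (x.1 : ℝ≥0∞)}.indicator
        (fun _ => (1 : ℝ≥0∞)) x) = ({n | T n x.2 ≤ (x.1 : ℝ≥0∞)}.encard : ℝ≥0∞) := by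
      rw [← ENNReal.tsum_set_one, tsum_subtype {n | T n x.2 ≤ (x.1 : ℝ≥0∞)} fun _ => (1 : ℝ≥0∞)]
      rfl
    rw [h1]
    by_cases hf : {n | T n x.2 ≤ (x.1 : ℝ≥0∞)}.Finite
    · rw [← hf.cast_ncard_eq]
      simp [count]
    · rw [Set.Infinite.encard_eq hf]
      simp [count, Set.Infinite.ncard hf]
  rw [heq]
  refine (Measurable.tsum fun n => ?_).ennreal_toReal.nat_floor
  exact measurable_const.indicator
    (measurableSet_le ((hT n).comp measurable_snd) measurable_fst.coe_nnreal_ennreal)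

lemma measurable_count_apply [MeasurableSpace Ω] (hT : ∀ n, Measurable (T n)) (t : ℝ≥0) :
    Measurable (count T t) := by
  have h : Measurable fun ω : Ω => (t, ω) := measurable_prodMk_left
  exact (measurable_count hT).comp h

end Count

/-- The points of a counting function, the counting function being observed along a countable
dense set of times only. -/
noncomputable def arrival (c : ℝ≥0 → ℕ) (n : ℕ) : ℝ≥0∞ :=
  ⨅ k : ℕ, if n < c (TopologicalSpace.denseSeq ℝ≥0 k)
    then (TopologicalSpace.denseSeq ℝ≥0 k : ℝ≥0∞) else ∞

/-- The infimum is countable and each term reads a single coordinate, which is what the product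
σ-algebra on paths requires. -/
lemma measurable_arrival : Measurable arrival := by
  refine measurable_pi_lambda _ fun n => Measurable.iInf fun k => ?_
  refine Measurable.ite ?_ measurable_const measurable_const
  exact measurableSet_lt measurable_const (measurable_pi_apply _)

lemma monotone_arrival (c : ℝ≥0 → ℕ) : Monotone (arrival c) := by
  intro m n hmn
  refine iInf_mono fun k => ?_
  split_ifs with h1 h2
  · exact le_rfl
  · exact le_top
  · omega
  · exact le_rfl

lemma arrival_anti {c c' : ℝ≥0 → ℕ} (h : ∀ t, c' t ≤ c t) (n : ℕ) :
    arrival c n ≤ arrival c' n := by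
  refine iInf_mono fun k => ?_
  split_ifs with h1 h2
  · exact le_rfl
  · exact le_top
  · exact absurd (lt_of_lt_of_le ‹_› (h _)) h1
  · exact le_rfl

/-- Since `n < count T t ω` means `T n ω ≤ t`, the infimum runs over the dense times after `T n ω`,
which come arbitrarily close to it. -/
lemma arrival_count {Ω : Type*} {T : ℕ → Ω → ℝ≥0∞} {ω : Ω} (hT : Monotone fun n => T n ω)
    (hfin : ∀ t : ℝ≥0, {n | T n ω ≤ (t : ℝ≥0∞)}.Finite) (n : ℕ) :
    arrival (fun t => count T t ω) n = T n ω := by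
  unfold arrival
  simp_rw [lt_count_iff hT (hfin _)]
  refine le_antisymm ?_ (le_iInf fun k => ?_)
  · refine le_of_forall_gt_imp_ge_of_dense fun a ha => ?_
    obtain ⟨u, hu1, hu2⟩ := ENNReal.lt_iff_exists_nnreal_btwn.1 ha
    obtain ⟨v, hv1, hv2⟩ := ENNReal.lt_iff_exists_nnreal_btwn.1 hu1
    obtain ⟨k, hk⟩ := (TopologicalSpace.denseRange_denseSeq ℝ≥0).exists_mem_open isOpen_Ioo
      (Set.nonempty_Ioo.2 (ENNReal.coe_lt_coe.1 hv2))
    refine iInf_le_of_le k ?_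
    rw [if_pos (hv1.le.trans (ENNReal.coe_le_coe.2 hk.1.le))]
    exact (ENNReal.coe_le_coe.2 hk.2.le).trans hu2.le
  · split_ifs with h
    · exact h
    · exact le_top

/-! ### The conditional survival probability given the shocks -/

/-- The probability that the second component, having accumulated the deterioration `x` at shocks
before `t`, is alive at time `t`. -/
noncomputable def SystemParams.residual (θ : SystemParams) (t : ℝ≥0) (x : ℝ) : ℝ :=
  θ.lawG.real {γ | ∃ n : ℕ, γ (t + 1 / (n + 1)) + x ≤ θ.L}

/-- Besides the comparison, this monotonicity supplies the measurability of `residual` in the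
accumulated damage. -/
lemma SystemParams.antitone_residual (θ : SystemParams) [IsFiniteMeasure θ.lawG] (t : ℝ≥0) :
    Antitone (θ.residual t) := fun x y hxy =>
  measureReal_mono fun _ ⟨n, hn⟩ => ⟨n, by linarith⟩

lemma SystemParams.q_mem (θ : SystemParams) (t : ℝ≥0) : θ.q t ∈ Set.Icc (0 : ℝ) 1 := by
  have := θ.p_mem t
  simp only [SystemParams.q, Set.mem_Icc] at *
  constructor <;> linarith

lemma SystemParams.measurable_q (θ : SystemParams) : Measurable θ.q :=
  measurable_const.sub θ.measurable_p

namespace System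

variable {Ω : Type*} (S : System Ω) (θ : SystemParams)

/-- The probability of survival of the first component given the shocks. -/
noncomputable def expHazard (t : ℝ≥0) (ω : Ω) : ℝ :=
  (EReal.exp (-(S.cumulHazard θ t ω : EReal))).toReal

/-- The probability of no fatal shock given the shocks. -/
noncomputable def nonfatal (t : ℝ≥0) (ω : Ω) : ℝ :=
  ∏ i ∈ Finset.range (S.N t ω), θ.q (S.T i ω).toNNReal

/-- The probability of survival of the system given the shocks. -/
noncomputable def survival (t : ℝ≥0) (ω : Ω) : ℝ :=
  S.expHazard θ t ω * θ.residual t (S.A t ω).2 * S.nonfatal θ t ω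

lemma expHazard_mem (t : ℝ≥0) (ω : Ω) : S.expHazard θ t ω ∈ Set.Icc (0 : ℝ) 1 := by
  refine ⟨ENNReal.toReal_nonneg, ENNReal.toReal_le_of_le_ofReal zero_le_one ?_⟩
  simp [EReal.coe_ennreal_nonneg]

lemma nonfatal_mem (t : ℝ≥0) (ω : Ω) : S.nonfatal θ t ω ∈ Set.Icc (0 : ℝ) 1 :=
  ⟨Finset.prod_nonneg fun _ _ => (θ.q_mem _).1,
    Finset.prod_le_one (fun _ _ => (θ.q_mem _).1) fun _ _ => (θ.q_mem _).2⟩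

section Measurability

variable {S} [MeasurableSpace Ω]

lemma measurable_N (hT : ∀ n, Measurable (S.T n)) (t : ℝ≥0) : Measurable (S.N t) :=
  measurable_count_apply hT t

lemma measurable_A_comp (hT : ∀ n, Measurable (S.T n)) (hV : ∀ n, Measurable (S.V n))
    {α : Type*} [MeasurableSpace α] {f : α → ℝ≥0} {g : α → Ω} (hf : Measurable f)
    (hg : Measurable g) : Measurable fun x => S.A (f x) (g x) := by
  have h1 : Measurable fun x : ℕ × Ω => ∑ k ∈ Finset.range x.1, S.V k x.2 :=
    measurable_from_prod_countable_right fun n =>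
      Finset.measurable_sum (Finset.range n) fun k _ => hV k
  have h2 : Measurable fun x => S.N (f x) (g x) := (measurable_count hT).comp (hf.prodMk hg)
  exact h1.comp (h2.prodMk hg)

lemma measurable_A (hT : ∀ n, Measurable (S.T n)) (hV : ∀ n, Measurable (S.V n))
    (t : ℝ≥0) : Measurable (S.A t) :=
  measurable_A_comp hT hV measurable_const measurable_id

lemma measurable_expHazard (hT : ∀ n, Measurable (S.T n))
    (hV : ∀ n, Measurable (S.V n)) (t : ℝ≥0) : Measurable (S.expHazard θ t) := by
  have h : Measurable (S.cumulHazard θ t) := by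
    refine Measurable.lintegral_prod_left' (f := fun x : ℝ × Ω =>
      (θ.h x.1.toNNReal : ℝ≥0∞) + ENNReal.ofReal (S.A x.1.toNNReal x.2).1) ?_
    have h1 : Measurable fun x : ℝ × Ω => x.1.toNNReal := measurable_fst.real_toNNReal
    have h2 : Measurable fun x : ℝ × Ω => S.A x.1.toNNReal x.2 :=
      measurable_A_comp hT hV h1 measurable_snd
    have h3 : Measurable fun x : ℝ × Ω => (θ.h x.1.toNNReal : ℝ≥0∞) :=
      (θ.measurable_h.comp h1).coe_nnreal_ennreal
    exact h3.add h2.fst.ennreal_ofReal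
  have h' : Measurable fun ω => -(S.cumulHazard θ t ω : EReal) :=
    continuous_neg.measurable.comp h.coe_ereal_ennreal
  exact (EReal.measurable_exp.comp h').ennreal_toReal

lemma measurable_nonfatal (hT : ∀ n, Measurable (S.T n)) (t : ℝ≥0) : Measurable (S.nonfatal θ t) := by
  have h : Measurable fun x : ℕ × Ω => ∏ i ∈ Finset.range x.1, θ.q (S.T i x.2).toNNReal :=
    measurable_from_prod_countable_right fun n =>
      Finset.measurable_prod (Finset.range n) fun k _ => θ.measurable_q.comp (hT k).ennreal_toNNReal
  exact h.comp ((measurable_N hT t).prodMk measurable_id)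

lemma measurable_survival [IsFiniteMeasure θ.lawG] (hT : ∀ n, Measurable (S.T n))
    (hV : ∀ n, Measurable (S.V n)) (t : ℝ≥0) : Measurable (S.survival θ t) :=
  ((measurable_expHazard θ hT hV t).mul ((θ.antitone_residual t).measurable.comp
    (measurable_A hT hV t).snd)).mul (measurable_nonfatal θ hT t)

end Measurability

variable {S θ}

lemma A_le {S' : System Ω} {ω : Ω} {s t : ℝ≥0} (hV : ∀ n, S.V n ω = S'.V n ω)
    (hV0 : ∀ n, 0 ≤ S'.V n ω) (hN : S.N s ω ≤ S'.N t ω) : S.A s ω ≤ S'.A t ω := by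
  unfold A
  simp_rw [hV]
  exact Finset.sum_le_sum_of_subset_of_nonneg (Finset.range_mono hN) fun n _ _ => hV0 n

/-- Given the increments, delaying the shocks improves the survival probability. -/
lemma survival_le [IsFiniteMeasure θ.lawG] (hq : Monotone θ.q) {S' : System Ω} {ω : Ω}
    (hV : ∀ n, S.V n ω = S'.V n ω) (hV0 : ∀ n, 0 ≤ S.V n ω)
    (hT : ∀ n, S.T n ω ≤ S'.T n ω) (hT' : Monotone fun n => S'.T n ω)
    (hfin : ∀ t : ℝ≥0, {n | S.T n ω ≤ (t : ℝ≥0∞)}.Finite) (t : ℝ≥0) :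
    S.survival θ t ω ≤ S'.survival θ t ω := by
  have hN : ∀ s, S'.N s ω ≤ S.N s ω := fun s => count_anti hT (hfin s)
  have hA : ∀ s, S'.A s ω ≤ S.A s ω := fun s => A_le (fun n => (hV n).symm) hV0 (hN s)
  have hH : S'.cumulHazard θ t ω ≤ S.cumulHazard θ t ω :=
    lintegral_mono fun s => add_le_add le_rfl (ENNReal.ofReal_le_ofReal (hA _).1)
  have h1 : S.expHazard θ t ω ≤ S'.expHazard θ t ω := by
    refine ENNReal.toReal_mono ?_ (EReal.exp_monotone (EReal.neg_le_neg_iff.2 ?_))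
    · exact (lt_of_le_of_lt (EReal.exp_le_one_iff.2 (by simp [EReal.coe_ennreal_nonneg]))
        ENNReal.one_lt_top).ne
    · exact EReal.coe_ennreal_le_coe_ennreal_iff.2 hH
  have h3 : S.nonfatal θ t ω ≤ S'.nonfatal θ t ω := by
    unfold nonfatal
    -- Discard the factors of the surplus shocks, each at most one, then compare the rest one by
    -- one.
    refine (Finset.prod_le_prod_of_subset_of_le_one (Finset.range_mono (hN t))
      (fun _ _ => (θ.q_mem _).1) fun _ _ _ => (θ.q_mem _).2).trans ?_
    refine Finset.prod_le_prod (fun _ _ => (θ.q_mem _).1) fun i hi => hq ?_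
    -- The later arrival must be finite: `toNNReal` sends `∞` to `0` and is monotone only below `∞`.
    have hle : S'.T i ω ≤ t := (lt_count_iff hT' ((hfin t).subset fun n hn =>
      (hT n).trans hn)).1 (Finset.mem_range.1 hi)
    exact ENNReal.toNNReal_mono (hle.trans_lt ENNReal.coe_lt_top).ne (hT i)
  have h2 := θ.antitone_residual t (hA t).2
  exact mul_le_mul (mul_le_mul h1 h2 measureReal_nonneg (S'.expHazard_mem θ t ω).1) h3
    (S.nonfatal_mem θ t ω).1 (mul_nonneg (S'.expHazard_mem θ t ω).1 measureReal_nonneg)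

end System

end ShockModel
namespace ShockModel

/-! ### The survival function of the system -/

section

variable {Ω : Type*} [MeasurableSpace Ω] {P : Measure Ω} {lam : ShockIntensity}

lemma IsPoissonArrivals.ae_monotone {T : ℕ → Ω → ℝ≥0∞} (hT : IsPoissonArrivals P lam T) :
    ∀ᵐ ω ∂P, Monotone fun n => T n ω := by
  filter_upwards [hT.ordered] with ω hω
  refine monotone_nat_of_le_succ fun n => ?_
  rcases hω n with h | h
  · exact h.le
  · rw [h.1, h.2]

namespace System

variable {S : System Ω} {θ : SystemParams}

lemma IsModel.ae_nonneg_V (hS : S.IsModel P θ lam) : ∀ᵐ ω ∂P, ∀ n, 0 ≤ S.V n ω := by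
  refine ae_all_iff.2 fun n => ?_
  have h := θ.nonneg_μ
  rw [← (hS.law_V n).map_eq] at h
  filter_upwards [ae_of_ae_map (hS.law_V n).aemeasurable h] with ω hω
  exact ⟨hω.1, hω.2⟩

lemma IsModel.isProbabilityMeasure_lawG [IsProbabilityMeasure P] (hS : S.IsModel P θ lam) :
    IsProbabilityMeasure θ.lawG :=
  hS.law_G.isProbabilityMeasure_iff.1 inferInstance

/-- The shocks accumulated up to time `t` being constant on a right neighbourhood of `t`, the
survival of the second component at `t` only depends on them and on its intrinsic deterioration. -/
lemma lt_τ₂_iff {Ω : Type*} {S : System Ω} {ω : Ω}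
    (hV0 : ∀ n, 0 ≤ S.V n ω) (hG : Monotone fun t => S.G t ω)
    (hfin : ∀ t : ℝ≥0, {n | S.T n ω ≤ (t : ℝ≥0∞)}.Finite) (t : ℝ≥0) :
    (t : ℝ≥0∞) < S.τ₂ θ ω ↔
      ∃ n : ℕ, S.G (t + 1 / (n + 1)) ω + (S.A t ω).2 ≤ θ.L := by
  have hA : ∀ {s u}, S.N s ω ≤ S.N u ω → (S.A s ω).2 ≤ (S.A u ω).2 :=
    fun h => (A_le (fun _ => rfl) hV0 h).2
  have hN : Monotone fun t => S.N t ω := monotone_count hfin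
  constructor
  · intro h
    obtain ⟨u, htu, hu⟩ := ENNReal.lt_iff_exists_nnreal_btwn.1 h
    rw [ENNReal.coe_lt_coe] at htu
    -- The time `t + 1 / (n + 1)` still precedes `τ₂`, so the deterioration there is at most `L`,
    -- and the shock damage at `t` is no larger.
    obtain ⟨n, hn⟩ := exists_nat_one_div_lt (K := ℝ≥0) (tsub_pos_of_lt htu)
    have hnu : t + 1 / (n + 1) < u := by
      rw [add_comm]
      exact lt_tsub_iff_right.1 hn
    refine ⟨n, ?_⟩
    have hD : S.deterioration (t + 1 / (n + 1)) ω ≤ θ.L := by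
      by_contra! hlt
      exact absurd ((ENNReal.coe_lt_coe.2 hnu).trans hu) (not_lt.2 (iInf₂_le
        (f := fun (s : ℝ≥0) (_ : θ.L < S.deterioration s ω) => (s : ℝ≥0∞)) _ hlt))
    exact (add_le_add le_rfl (hA (hN le_self_add))).trans hD
  · rintro ⟨n, hn⟩
    have hpos : (0 : ℝ≥0) < 1 / (n + 1) := by positivity
    -- No shock occurs in `(t, u]`, so before `u` the deterioration is at most `G` at `t + 1 / (n +
    -- 1)` plus the damage at `t`; hence `τ₂ ≥ u > t`.
    obtain ⟨u, htu, hub, hNu⟩ := exists_count_eq_right hfin (lt_add_of_pos_right t hpos)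
    refine (ENNReal.coe_lt_coe.2 htu).trans_le (le_iInf₂ fun s hs => ENNReal.coe_le_coe.2 ?_)
    by_contra! hsu
    refine absurd hs (not_lt.2 ?_)
    exact (add_le_add (hG (hsu.le.trans hub)) (hA ((hN hsu.le).trans hNu.le))).trans hn

lemma IsModel.history_le (hS : S.IsModel P θ lam) (t : ℝ≥0) :
    S.history t ≤ ‹MeasurableSpace Ω› :=
  iSup_le fun s => ((measurable_N hS.arrivals.measurable s).prodMk
    (measurable_A hS.arrivals.measurable hS.measurable_V s)).comap_le

/-- Carries the independence of `G` from the whole shock process over to the history. -/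
lemma history_le_comap {Ω : Type*} (S : System Ω) (t : ℝ≥0) :
    S.history t ≤ MeasurableSpace.comap (fun ω t => (S.N t ω, S.A t ω)) inferInstance := by
  refine iSup_le fun s => ?_
  have h : (fun ω => (S.N s ω, S.A s ω)) =
    (fun x : ℝ≥0 → ℕ × ℝ × ℝ => x s) ∘ fun ω t => (S.N t ω, S.A t ω) := rfl
  rw [h, ← MeasurableSpace.comap_comp]
  exact MeasurableSpace.comap_mono (measurable_pi_apply _).comap_le

lemma measurable_A_history {Ω : Type*} (S : System Ω) (t : ℝ≥0) : Measurable[S.history t] (S.A t) := by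
  have h : Measurable[S.history t] fun ω => (S.N t ω, S.A t ω) :=
    Measurable.mono (comap_measurable _) (le_iSup (fun s : Set.Iic t =>
      MeasurableSpace.comap (fun ω => (S.N s ω, S.A s ω)) inferInstance) ⟨t, Set.mem_Iic.2 le_rfl⟩) le_rfl
  exact measurable_snd.comp h

lemma IsModel.measurable_τ₃ (hS : S.IsModel P θ lam) : Measurable S.τ₃ := by
  refine Measurable.iInf fun n => ?_
  classical
  have h : (fun ω => ⨅ (_ : ω ∈ S.fatal n), S.T n ω) =
      fun ω => if ω ∈ S.fatal n then S.T n ω else ∞ := by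
    funext ω
    split_ifs with hω <;> simp [hω]
  rw [h]
  exact Measurable.ite (hS.measurable_fatal n) (hS.arrivals.measurable n) measurable_const

/-- Integration over the intrinsic deterioration of the second component. -/
lemma IsModel.integral_mul_indicator [IsProbabilityMeasure P] (hS : S.IsModel P θ lam) (t : ℝ≥0)
    {f : Ω → ℝ} (hf : Measurable[S.history t] f) (hfi : Integrable f P) :
    ∫ ω, f ω * {ω | ∃ n : ℕ, S.G (t + 1 / (n + 1)) ω + (S.A t ω).2 ≤ θ.L}.indicator 1 ω ∂P =
      ∫ ω, f ω * θ.residual t (S.A t ω).2 ∂P := by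
  have hlawG := hS.isProbabilityMeasure_lawG
  have hm := hS.history_le t
  let G : Ω → ℝ≥0 → ℝ := fun ω t => S.G t ω
  let Z : Ω → ℝ × ℝ := fun ω => (f ω, (S.A t ω).2)
  have hG : Measurable G := measurable_pi_lambda _ hS.measurable_G
  have hZ : Measurable[S.history t] Z := hf.prodMk (S.measurable_A_history t).snd
  have hZ' : Measurable Z := hZ.mono hm le_rfl
  -- `Z` is a function of the history, so the joint law of `G` and `Z` is a product and `G` can be
  -- integrated out first by Fubini.
  have hind : IndepFun G Z P := by
    have h := hS.indep_G
    rw [IndepFun_iff_Indep] at h ⊢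
    exact indep_of_indep_of_le_right h (hZ.comap_le.trans (S.history_le_comap t))
  have hmap := (indepFun_iff_map_prod_eq_prod_map_map hG.aemeasurable hZ'.aemeasurable).1 hind
  have hGlaw : P.map G = θ.lawG := hS.law_G.map_eq
  rw [hGlaw] at hmap
  have : IsProbabilityMeasure (P.map Z) := Measure.isProbabilityMeasure_map hZ'.aemeasurable
  let D : Set ((ℝ≥0 → ℝ) × ℝ × ℝ) := {x | ∃ n : ℕ, x.1 (t + 1 / (n + 1)) + x.2.2 ≤ θ.L}
  have hD : MeasurableSet D := by
    have : D = ⋃ n : ℕ, {x | x.1 (t + 1 / (n + 1)) + x.2.2 ≤ θ.L} := by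
      ext x; simp [D]
    rw [this]
    refine MeasurableSet.iUnion fun n => measurableSet_le ?_ measurable_const
    exact ((measurable_pi_apply _).comp measurable_fst).add measurable_snd.snd
  let F : (ℝ≥0 → ℝ) × ℝ × ℝ → ℝ := fun x => x.2.1 * D.indicator 1 x
  have hF : Measurable F := measurable_snd.fst.mul (measurable_one.indicator hD)
  have hFi : Integrable F (θ.lawG.prod (P.map Z)) := by
    rw [← hmap, integrable_map_measure hF.aestronglyMeasurable
      (hG.prodMk hZ').aemeasurable]
    refine hfi.mono (hF.comp (hG.prodMk hZ')).aestronglyMeasurable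
      (Filter.Eventually.of_forall fun ω => ?_)
    simp only [Function.comp_apply, F, Z, norm_mul]
    refine mul_le_of_le_one_right (norm_nonneg _) ?_
    refine (norm_indicator_le_norm_self _ _).trans ?_
    simp
  calc _ = ∫ ω, F (G ω, Z ω) ∂P := rfl
    _ = ∫ x, F x ∂(θ.lawG.prod (P.map Z)) := by
      rw [← hmap, integral_map (hG.prodMk hZ').aemeasurable hF.aestronglyMeasurable]
    _ = ∫ z, z.1 * θ.residual t z.2 ∂(P.map Z) := by
      rw [integral_prod_symm _ hFi]
      refine integral_congr_ae (Filter.Eventually.of_forall fun z => ?_)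
      simp only [F]
      rw [integral_const_mul]
      congr 1
      have hDz : MeasurableSet {γ : ℝ≥0 → ℝ | ∃ n : ℕ, γ (t + 1 / (n + 1)) + z.2 ≤ θ.L} :=
        measurable_prodMk_right (y := z) hD
      exact integral_indicator_one hDz
    _ = _ := by
      rw [integral_map hZ'.aemeasurable]
      exact (measurable_fst.mul ((θ.antitone_residual t).measurable.comp
        measurable_snd)).aestronglyMeasurable

/-- The survival function of the system is the mean of the survival probability given the shocks. -/
lemma IsModel.measure_lt_lifetime [IsProbabilityMeasure P] (hS : S.IsModel P θ lam) (t : ℝ≥0) :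
    P {ω | (t : ℝ≥0∞) < S.lifetime θ ω} = ENNReal.ofReal (∫ ω, S.survival θ t ω ∂P) := by
  have hlawG := hS.isProbabilityMeasure_lawG
  have hm := hS.history_le t
  let E₁ : Set Ω := {ω | (t : ℝ≥0∞) < S.τ₁ ω}
  let E₂ : Set Ω := {ω | (t : ℝ≥0∞) < S.τ₂ θ ω}
  let E₃ : Set Ω := {ω | (t : ℝ≥0∞) < S.τ₃ ω}
  let E : Set Ω := {ω | (t : ℝ≥0∞) < S.τ₁ ω ∧ (t : ℝ≥0∞) < S.τ₂ θ ω ∧ (t : ℝ≥0∞) < S.τ₃ ω}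
  let B : Set Ω := {ω | ∃ n : ℕ, S.G (t + 1 / (n + 1)) ω + (S.A t ω).2 ≤ θ.L}
  have hA : Measurable (S.A t) := measurable_A hS.arrivals.measurable hS.measurable_V t
  have hB : MeasurableSet B := by
    have : B = ⋃ n : ℕ, {ω | S.G (t + 1 / (n + 1)) ω + (S.A t ω).2 ≤ θ.L} := by
      ext ω; simp [B]
    rw [this]
    exact MeasurableSet.iUnion fun n =>
      measurableSet_le ((hS.measurable_G _).add hA.snd) measurable_const
  have hE₁ : MeasurableSet E₁ := measurableSet_lt measurable_const hS.measurable_τ₁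
  have hE₃ : MeasurableSet E₃ := measurableSet_lt measurable_const hS.measurable_τ₃
  -- `τ₂` is an infimum over uncountably many times, so `E₂` is not obviously measurable; it is
  -- replaced by the almost surely equal measurable event `B`.
  have hE₂B : ∀ᵐ ω ∂P, ω ∈ E₂ ↔ ω ∈ B := by
    filter_upwards [hS.ae_nonneg_V, hS.monotone_G, hS.arrivals.locallyFinite] with ω h1 h2 h3
    exact lt_τ₂_iff h1 h2 h3 t
  have hE : NullMeasurableSet E P := by
    refine (hE₁.inter (hB.inter hE₃)).nullMeasurableSet.congr ?_
    filter_upwards [hE₂B] with ω hω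
    exact propext ⟨fun h => ⟨h.1, hω.2 h.2.1, h.2.2⟩, fun h => ⟨h.1, hω.1 h.2.1, h.2.2⟩⟩
  have hlife : {ω | (t : ℝ≥0∞) < S.lifetime θ ω} = E := by
    ext ω; simp [E, lifetime]
  have ha : P⟦E₁|S.history t⟧ =ᵐ[P] S.expHazard θ t := hS.hazard t
  have hc : P⟦E₃|S.history t⟧ =ᵐ[P] S.nonfatal θ t := hS.bernoulli t
  have hb : P⟦E₂|S.history t⟧ =ᵐ[P] P⟦B|S.history t⟧ := by
    refine condExp_congr_ae ?_
    filter_upwards [hE₂B] with ω hω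
    by_cases h : ω ∈ B
    · rw [Set.indicator_of_mem h, Set.indicator_of_mem (hω.2 h)]
    · rw [Set.indicator_of_notMem h, Set.indicator_of_notMem (mt hω.1 h)]
  let f : Ω → ℝ := P⟦E₁|S.history t⟧ * P⟦E₃|S.history t⟧
  have hfm : StronglyMeasurable[S.history t] f := stronglyMeasurable_condExp.mul stronglyMeasurable_condExp
  have hf : f =ᵐ[P] fun ω => S.expHazard θ t ω * S.nonfatal θ t ω := ha.mul hc
  have hf1 : ∀ᵐ ω ∂P, ‖f ω‖ ≤ 1 := by
    filter_upwards [hf] with ω hω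
    have h1 := S.expHazard_mem θ t ω
    have h3 := S.nonfatal_mem θ t ω
    rw [hω, Real.norm_of_nonneg (mul_nonneg h1.1 h3.1)]
    exact mul_le_one₀ h1.2 h3.1 h3.2
  have hfi : Integrable f P :=
    Integrable.of_bound (hfm.mono hm).aestronglyMeasurable 1 hf1
  have hBi : Integrable (B.indicator (1 : Ω → ℝ)) P :=
    (integrable_const (1 : ℝ)).indicator hB
  -- The conditional probability of `B` is never computed: under the expectation, the bounded
  -- history-measurable `f` allows it to be replaced by the indicator of `B`.
  have hpull : P[f * B.indicator (1 : Ω → ℝ)|S.history t] =ᵐ[P] f * P⟦B|S.history t⟧ :=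
    condExp_stronglyMeasurable_mul_of_bound hm hfm hBi 1 hf1
  have key : P.real E = ∫ ω, S.survival θ t ω ∂P := by
    calc P.real E = ∫ ω, E.indicator (1 : Ω → ℝ) ω ∂P := by
          rw [integral_indicator₀ hE]; simp
      _ = ∫ ω, (P⟦E|S.history t⟧) ω ∂P := (integral_condExp hm).symm
      _ = ∫ ω, (f * P⟦B|S.history t⟧) ω ∂P := by
          refine integral_congr_ae ?_
          filter_upwards [hS.condIndep t, hb] with ω h1 h2
          refine h1.trans ?_
          simp only [f, Pi.mul_apply]
          rw [← h2]
          ring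
      _ = ∫ ω, (P[f * B.indicator (1 : Ω → ℝ)|S.history t]) ω ∂P := integral_congr_ae hpull.symm
      _ = ∫ ω, f ω * B.indicator 1 ω ∂P := integral_condExp hm
      _ = ∫ ω, f ω * θ.residual t (S.A t ω).2 ∂P :=
          hS.integral_mul_indicator t hfm.measurable hfi
      _ = ∫ ω, S.survival θ t ω ∂P := by
          refine integral_congr_ae ?_
          filter_upwards [hf] with ω hω
          simp only [hω, survival]
          ring
  rw [hlife, ← key, ofReal_measureReal]

end System

end

end ShockModel
namespace ShockModel

/-! ### Comparison of two systems -/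

namespace System

/-- The shocks of a system, realized on the space of sequences. -/
noncomputable def canonical : System ((ℕ → ℝ × ℝ) × (ℕ → ℝ≥0∞)) where
  T n x := x.2 n
  V n x := x.1 n
  -- The last three fields are placeholders: `survival` reads only `T` and `V`.
  G _ _ := 0
  fatal _ := ∅
  τ₁ _ := 0

variable {Ω : Type*} [MeasurableSpace Ω] {P : Measure Ω} [IsProbabilityMeasure P]
  {θ : SystemParams}

/-- The mean survival probability given the shocks in terms of the law of the shocks. -/
lemma integral_survival [IsFiniteMeasure θ.lawG] {S : System Ω} (hT : ∀ n, Measurable (S.T n))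
    (hV : ∀ n, Measurable (S.V n)) (hlaw : ∀ n, HasLaw (S.V n) θ.μ P) (hind : iIndepFun S.V P)
    (hVT : IndepFun (fun ω n => S.V n ω) (fun ω n => S.T n ω) P) (t : ℝ≥0) :
    ∫ ω, S.survival θ t ω ∂P = ∫ x, canonical.survival θ t x
      ∂((Measure.infinitePi fun _ => θ.μ).prod (P.map fun ω n => S.T n ω)) := by
  have hmT : Measurable fun ω n => S.T n ω := measurable_pi_lambda _ hT
  have hmV : Measurable fun ω n => S.V n ω := measurable_pi_lambda _ hV
  have hVlaw := (iIndepFun.hasLaw_infinitePi hlaw hind hmV.aemeasurable).map_eq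
  rw [← hVlaw, ← (indepFun_iff_map_prod_eq_prod_map_map hmV.aemeasurable hmT.aemeasurable).1 hVT,
    integral_map (hmV.prodMk hmT).aemeasurable]
  · rfl
  · exact (measurable_survival θ (fun n => (measurable_pi_apply n).comp measurable_snd)
      (fun n => (measurable_pi_apply n).comp measurable_fst) t).aestronglyMeasurable

variable {Ω' : Type*} [MeasurableSpace Ω'] {P' : Measure Ω'} [IsProbabilityMeasure P']
  {lam lam' : ShockIntensity}

/-- The counting process of the more frequent shocks, suitably slowed down, has the law of the
counting process of the less frequent ones. -/
lemma map_count_timeChange {T : ℕ → Ω → ℝ≥0∞} {T' : ℕ → Ω' → ℝ≥0∞}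
    (hT : IsPoissonArrivals P lam T) (hT' : IsPoissonArrivals P' lam' T')
    (hΛ : ∀ t, lam'.cumul t ≤ lam.cumul t) :
    P.map (fun ω t => count T (lam.timeChange lam' t) ω) =
      P'.map (fun ω t => count T' t ω) := by
  refine map_eq_of_hasIndepIncrements
    (fun s t => poissonMeasure (lam'.cumul t - lam'.cumul s))
    (measurable_count_apply hT.measurable <| lam.timeChange lam' ·)
    (measurable_count_apply hT'.measurable)
    ?_ ?_ ?_ ?_ ?_ hT'.indepIncrements ?_ hT'.law
  · have h0 : lam.timeChange lam' 0 = 0 :=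
      le_antisymm (ShockIntensity.timeChange_le hΛ 0) (zero_le)
    rw [h0]
    filter_upwards [hT.pos, hT.ae_monotone] with ω h1 h2 using count_zero h1 h2
  · filter_upwards [hT'.pos, hT'.ae_monotone] with ω h1 h2 using count_zero h1 h2
  · filter_upwards [hT.locallyFinite] with ω h
    exact (monotone_count h).comp (ShockIntensity.monotone_timeChange hΛ)
  · filter_upwards [hT'.locallyFinite] with ω h using monotone_count h
  -- A monotone time change maps ordered times to ordered times, so independence of increments is
  -- inherited.
  · exact fun n t ht => hT.indepIncrements n (fun i => lam.timeChange lam' (t i))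
      ((ShockIntensity.monotone_timeChange hΛ).comp ht)
  · intro s t hst
    have h := hT.law _ _ (ShockIntensity.monotone_timeChange hΛ hst)
    rwa [ShockIntensity.cumul_timeChange hΛ, ShockIntensity.cumul_timeChange hΛ] at h

/-- More frequent shocks decrease the mean survival probability. -/
lemma IsModel.integral_survival_le {S : System Ω} {S' : System Ω'}
    (hS : S.IsModel P θ lam) (hS' : S'.IsModel P' θ lam')
    (hΛ : ∀ t, lam'.cumul t ≤ lam.cumul t) (hq : Monotone θ.q) (t : ℝ≥0) :
    ∫ ω, S.survival θ t ω ∂P ≤ ∫ ω, S'.survival θ t ω ∂P' := by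
  have hlawG := hS.isProbabilityMeasure_lawG
  -- Points of the slowed counting function, built as a measurable map on sequences so that
  -- independence from the increments passes to them.
  let slow : (ℕ → ℝ≥0∞) → ℕ → ℝ≥0∞ := fun x =>
    arrival fun t => count (fun n (x : ℕ → ℝ≥0∞) => x n) (lam.timeChange lam' t) x
  have hcount : ∀ t, Measurable fun x : ℕ → ℝ≥0∞ => count (fun n x => x n) t x :=
    measurable_count_apply measurable_pi_apply
  have hslow : Measurable slow :=
    measurable_arrival.comp (measurable_pi_lambda _ fun t => hcount _)
  have hmT : Measurable fun ω n => S.T n ω := measurable_pi_lambda _ hS.arrivals.measurable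
  -- An intermediate system on the same space, with the same increments and delayed shocks. Only its
  -- `survival` functional is used, so `IsModel` is not needed for it.
  let S₁ : System Ω := { S with T := fun n ω => slow (fun n => S.T n ω) n }
  have hS₁T : ∀ n, Measurable (S₁.T n) := fun n =>
    (measurable_pi_apply n).comp (hslow.comp hmT)
  have hmap : P.map (fun ω n => S₁.T n ω) = P'.map (fun ω n => S'.T n ω) := by
    have h1 : P.map (fun ω n => S₁.T n ω) =
        (P.map fun ω t => count S.T (lam.timeChange lam' t) ω).map arrival := by
      rw [Measure.map_map measurable_arrival]
      · rfl
      · exact measurable_pi_lambda _ fun t => measurable_N hS.arrivals.measurable _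
    have h2 : P'.map (fun ω n => S'.T n ω) =
        (P'.map fun ω t => count S'.T t ω).map arrival := by
      rw [Measure.map_map measurable_arrival]
      · refine Measure.map_congr ?_
        filter_upwards [hS'.arrivals.ae_monotone, hS'.arrivals.locallyFinite] with ω h1 h2
        exact (funext (arrival_count h1 h2)).symm
      · exact measurable_pi_lambda _ fun t => measurable_N hS'.arrivals.measurable _
    rw [h1, h2, map_count_timeChange hS.arrivals hS'.arrivals hΛ]
  calc ∫ ω, S.survival θ t ω ∂P ≤ ∫ ω, S₁.survival θ t ω ∂P := by
        have hbd : ∀ {S : System Ω}, (∀ n, Measurable (S.T n)) → (∀ n, Measurable (S.V n)) →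
            Integrable (S.survival θ t) P := fun {S} h1 h2 => by
          refine Integrable.of_bound (measurable_survival θ h1 h2 t).aestronglyMeasurable 1
            (Filter.Eventually.of_forall fun ω => ?_)
          have h1 := S.expHazard_mem θ t ω
          have h3 := S.nonfatal_mem θ t ω
          have h2 : 0 ≤ θ.residual t (S.A t ω).2 := measureReal_nonneg
          have h2' : θ.residual t (S.A t ω).2 ≤ 1 := measureReal_le_one
          rw [survival, Real.norm_of_nonneg (mul_nonneg (mul_nonneg h1.1 h2) h3.1)]
          exact mul_le_one₀ (mul_le_one₀ h1.2 h2 h2') h3.1 h3.2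
        refine integral_mono_ae (hbd hS.arrivals.measurable hS.measurable_V)
          (hbd hS₁T hS.measurable_V) ?_
        filter_upwards [hS.ae_nonneg_V, hS.arrivals.ae_monotone, hS.arrivals.locallyFinite]
          with ω h1 h2 h3
        have hmono : Monotone fun n => S₁.T n ω :=
          monotone_arrival fun s => count S.T (lam.timeChange lam' s) ω
        refine survival_le (S := S) (S' := S₁) hq (fun _ => rfl) h1 (fun n => ?_) hmono h3 t
        -- Both arrivals are now points of counting functions, and the slowed one is smaller because
        -- the time change satisfies `σ(s) ≤ s`.
        rw [← arrival_count h2 h3 n]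
        exact arrival_anti (fun s => monotone_count h3 (ShockIntensity.timeChange_le hΛ s)) n
    _ = ∫ ω, S'.survival θ t ω ∂P' := by
        rw [integral_survival hS₁T hS.measurable_V hS.law_V hS.iIndep_V
            (hS.indep_V_T.comp measurable_id hslow),
          integral_survival hS'.arrivals.measurable hS'.measurable_V hS'.law_V hS'.iIndep_V
            hS'.indep_V_T, hmap]

end System

end ShockModel

theorem mainTheorem8 {Ω : Type*} [MeasurableSpace Ω] (P : Measure Ω) [IsProbabilityMeasure P]
    {Ω' : Type*} [MeasurableSpace Ω'] (P' : Measure Ω') [IsProbabilityMeasure P']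
    (θ : ShockModel.SystemParams) (lam lam' : ShockModel.ShockIntensity)
    (S : ShockModel.System Ω) (S' : ShockModel.System Ω')
    (hS : S.IsModel P θ lam) (hS' : S'.IsModel P' θ lam')
    (hΛ : ∀ t : ℝ≥0, lam'.cumul t ≤ lam.cumul t) (hq : Monotone θ.q) :
    ShockModel.StochLE P (S.lifetime θ) P' (S'.lifetime θ) := by
  intro t
  rw [hS.measure_lt_lifetime t, hS'.measure_lt_lifetime t]
  exact ENNReal.ofReal_le_ofReal (hS.integral_survival_le hS' hΛ hq t)
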